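/- Let $r\ge 1$, $n\ge 0$. An $r$-Stirling permutation of order $n$ is a word $\sigma=\sigma_1\cdots\sigma_{rn}$ that rearranges the multiset $\{1^r,2^r,\dots,n^r\}$ and satisfies $\sigma_s\ge\sigma_k$ whenever $k<s<\ell$ and $\sigma_k=\sigma_\ell$; let $\mathcal Q_{n,r}$ be the set of these words. Let $\Phi_r$ be the map that replaces, for all $i$ and $\ell$, the $\ell$-th occurrence (from the left) of $i$ in $\sigma$ by $ri-\ell+1$. For $\pi\in\Phi_r(\mathcal Q_{n,r})$ put $\pi_0=0$, and let $\mathrm{lpk}(\pi)$ (respectively $\mathrm{ipk}(\pi)$) be the number of $i$ with $1\le i\le rn-r+1$ (respectively $2\le i\le rn-r+1$) such that $\pi_{i-1}<\pi_i>\pi_{i+1}>\dots>\pi_{i+r-1}$. Define $$M_{n,r}(x)=\sum_{\pi\in\Phi_r(\mathcal Q_{n,r})}x^{\mathrm{ipk}(\pi)},\qquad \widetilde M_{n,r}(x)=\sum_{\pi\in\Phi_r(\mathcal Q_{n,r})}x^{\mathrm{lpk}(\pi)}.$$ A polynomial $f\in\mathbb R[x]$ is Hurwitz stable if it is identically zero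 or $f(z)\ne0$ for all $z\in\mathbb C$ with $\operatorname{Re}z>0$. For nonzero real-rooted $f,g\in\mathbb R[x]$ with zeros $r_1\ge r_2\ge\cdots$ and $s_1\ge s_2\ge\cdots$, counted with multiplicity, write $g\preceq f$ if $\deg f-\deg g\in\{0,1\}$ and $\cdots\le r_3\le s_2\le r_2\le s_1\le r_1$. Write $g\ll f$ if $g\preceq f$ and the leading coefficients of $f,g$ have the same sign, or $f\preceq g$ and they have opposite signs; by convention also $0\ll f$ and $f\ll0$ for every real-rooted or zero polynomial $f$. For a polynomial $p$ of degree at most $n$, its symmetric decomposition with respect to $n$ is the unique pair $(a,b)$ of real polynomials with $p=a+xb$, $x^na(1/x)=a(x)$ and $x^{n-1}b(1/x)=b(x)$. A polynomial $p=\sum_{k=0}^d p_kx^k$ of degree $d$ is alternatingly increasing if $0\le p_0\le p_d\le p_1\le p_{d-1}\le\dots\le p_{\lfloor (d+1)/2\rfloor}$. **Proposition.** For every integer $n\ge0$: 1. there is a polynomial $T_{n,2}\in\mathbb R[x]$ with $(1+x)T_{n,2}(x)=xM_{n,2}(x^2)+\widetilde M_{n,2}(x^2)$, and this $T_{n,2}$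 is Hurwitz stable; 2. the symmetric decomposition $(a,b)$ of $\widetilde M_{n,2}$ with respect to $n$ exists and satisfies $b\ll a$; 3. both $M_{n,2}$ and $\widetilde M_{n,2}$ are alternatingly increasing. -/

import Mathlib

open Polynomial

noncomputable section

/-- A (univariate) real polynomial is Hurwitz stable if it is identically zero or has no zero in
the open right half-plane. -/
def HurwitzStable (f : ℝ[X]) : Prop :=
  f = 0 ∨ ∀ z : ℂ, 0 < z.re → aeval z f ≠ 0

/-- `Precedes g f` is `g ⪯ f`: the polynomials `f` and `g` are real-rooted, with zeros
`r 0 ≥ r 1 ≥ …` and `s 0 ≥ s 1 ≥ …` listed with multiplicity, and either `g` interlaces `f`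
(`deg f = deg g + 1` and `… ≤ r 2 ≤ s 1 ≤ r 1 ≤ s 0 ≤ r 0`) or `g` alternates left of `f`
(the same chain with `deg f = deg g`). The monotonicity of `r` and `s` follows from the chain. -/
def Precedes (g f : ℝ[X]) : Prop :=
  f ≠ 0 ∧ g ≠ 0 ∧ ∃ (n m : ℕ) (r s : ℕ → ℝ),
    (n = m + 1 ∨ n = m) ∧
    f = C f.leadingCoeff * ∏ i ∈ Finset.range n, (X - C (r i)) ∧
    g = C g.leadingCoeff * ∏ i ∈ Finset.range m, (X - C (s i)) ∧
    (∀ i, i < m → s i ≤ r i) ∧ (∀ i, i + 1 < n → r (i + 1) ≤ s i)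

/-- `ProperPosition g f` is `g ≪ f`: either `g ⪯ f` and the leading coefficients have the same
sign, or `f ⪯ g` and they have opposite signs. By the usual convention the zero polynomial is in
proper position with every real-rooted polynomial, on both sides. -/
def ProperPosition (g f : ℝ[X]) : Prop :=
  (Precedes g f ∧ 0 < g.leadingCoeff * f.leadingCoeff) ∨
  (Precedes f g ∧ g.leadingCoeff * f.leadingCoeff < 0) ∨
  (g = 0 ∧ f.Splits) ∨ (f = 0 ∧ g.Splits)

/-- `p` is symmetric with respect to the integer `d`, that is, `x ^ d * p (1 / x) = p x`. For
negative `d` this says that `p = 0`. -/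
def IsSymmetricWrt (d : ℤ) (p : ℝ[X]) : Prop :=
  (∀ k : ℕ, d < k → p.coeff k = 0) ∧ ∀ i j : ℕ, (i : ℤ) + j = d → p.coeff i = p.coeff j

/-- `(a, b)` is the symmetric `𝓘ₙ`-decomposition of `p`. -/
def IsSymmetricDecomposition (n : ℕ) (p a b : ℝ[X]) : Prop :=
  p = a + X * b ∧ IsSymmetricWrt n a ∧ IsSymmetricWrt ((n : ℤ) - 1) b

/-- With `d = deg p`: `0 ≤ p₀ ≤ p_d ≤ p₁ ≤ p_{d-1} ≤ … ≤ p_{⌊(d+1)/2⌋}`. -/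
def AlternatinglyIncreasing (p : ℝ[X]) : Prop :=
  0 ≤ p.coeff 0 ∧
  (∀ i : ℕ, 2 * i ≤ p.natDegree → p.coeff i ≤ p.coeff (p.natDegree - i)) ∧
  (∀ i : ℕ, 2 * i + 1 ≤ p.natDegree → p.coeff (p.natDegree - i) ≤ p.coeff (i + 1))

/-- The `r`-Stirling permutations of order `n`: the words `w` that are rearrangements of the
multiset `{1^r, 2^r, …, n^r}`, such that every entry between two equal entries is at least as
large as these. -/
def stirlingPerms (n r : ℕ) : Finset (List ℕ) :=
  (Multiset.lists (r • (Finset.Icc 1 n).val)).toFinset.filter fun w =>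
    ∀ l < w.length, ∀ s < l, ∀ k < s, w.getD k 0 = w.getD l 0 → w.getD k 0 ≤ w.getD s 0

/-- The map `Φᵣ`, which replaces the `ℓ`-th occurrence of `a` (from the left) by `r a - ℓ + 1`. -/
def dualWord (r : ℕ) (w : List ℕ) : List ℕ :=
  w.mapIdx fun i a => r * a + 1 - (w.take (i + 1)).count a

/-- The dual set `Φᵣ(𝒬ₙ,ᵣ)`. -/
def dualStirlingPerms (n r : ℕ) : Finset (List ℕ) :=
  (stirlingPerms n r).image (dualWord r)

/-- The entry `π_i` of the word `π = π_1 π_2 ⋯`, with `π_0 = 0`. -/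
def entry (π : List ℕ) (i : ℕ) : ℕ := (0 :: π).getD i 0

/-- `π_{i-1} < π_i > π_{i+1} > ⋯ > π_{i+r-1}`. -/
def IsPeakAt (r : ℕ) (π : List ℕ) (i : ℕ) : Prop :=
  entry π (i - 1) < entry π i ∧ ∀ j < r - 1, entry π (i + j + 1) < entry π (i + j)

instance (r : ℕ) (π : List ℕ) : DecidablePred (IsPeakAt r π) :=
  fun _ => inferInstanceAs (Decidable (_ ∧ _))

/-- The number of interior peaks of a word of length `N`: peaks `i` with `2 ≤ i ≤ N - r + 1`. -/
def ipk (r : ℕ) (π : List ℕ) : ℕ :=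
  ((Finset.Icc 2 (π.length + 1 - r)).filter (IsPeakAt r π)).card

/-- The number of left peaks of a word of length `N`: peaks `i` with `1 ≤ i ≤ N - r + 1`. -/
def lpk (r : ℕ) (π : List ℕ) : ℕ :=
  ((Finset.Icc 1 (π.length + 1 - r)).filter (IsPeakAt r π)).card

/-- `Mₙ,ᵣ(x)`. -/
def interiorPeakPoly (n r : ℕ) : ℝ[X] := ∑ π ∈ dualStirlingPerms n r, X ^ ipk r π

/-- `M̃ₙ,ᵣ(x)`. -/
def leftPeakPoly (n r : ℕ) : ℝ[X] := ∑ π ∈ dualStirlingPerms n r, X ^ lpk r π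

/-- `T` is the polynomial `Tₙ,ᵣ(x)`, that is,
`(1 + x) Tₙ,ᵣ(x) = x Mₙ,ᵣ(x²) + M̃ₙ,ᵣ(x²)`. -/
def IsPeakT (n r : ℕ) (T : ℝ[X]) : Prop :=
  (1 + X) * T = X * (interiorPeakPoly n r).comp (X ^ 2) + (leftPeakPoly n r).comp (X ^ 2)

end

/-! The two copies of the largest letter in a Stirling permutation are adjacent, so dual words of
order `n + 1` arise by inserting the block `2n+2, 2n+1` anywhere into dual words of order `n`.
Counting how an insertion changes the peaks (`sum_insertPair`, `sum_insertPair_of_le`) gives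
first-order differential recurrences for both peak polynomials. They are solved by a pair `(b, c) =
peakHalves m`, palindromic with respect to `m` and `m - 1`: for `n = m + 1` the interior polynomial
is `b + x c`, the left one `x b + x c`. Hence `(x c, b)` is the symmetric decomposition of the
latter, and alternating increase amounts to `b` and `c` increasing up to the middle. Moreover `T = x
S` with `S = b(x²) + x c(x²)`. `S` obeys a recurrence that keeps all zeros in the open left
half-plane (`StrictlyStable.step`); this gives Hurwitz stability. By a Hermite–Biehler argument, the
even and odd parts of a strictly stable `S` yield real-rooted interlacing polynomials: a norm
inequality places the zeros of `b` on the negative axis, and a positive Wronskian separates them by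
zeros of `c`. The factor `x` adds the zero `0` on the right, whence `b ≪ x c`. -/

/-! ### Peaks under insertion of a descending pair. -/

/-- The number of peaks of the word `π` (other than at its last letter), where `a` is regarded as
the letter before `π`. -/
def peakCount : ℕ → List ℕ → ℕ
  | a, b :: c :: l => (if a < b ∧ c < b then 1 else 0) + peakCount b (c :: l)
  | _, _ => 0

theorem peakCount_of_le {a b : ℕ} (h : b ≤ a) (l : List ℕ) :
    peakCount a (b :: l) = peakCount b l := by
  cases l with
  | nil => simp [peakCount]
  | cons c l => simp [peakCount, h.not_gt]

theorem sum_peaks_eq_peakCount (a : ℕ) (l : List ℕ) :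
    ∑ j ∈ Finset.range (l.length - 1),
      (if (a :: l).getD j 0 < (a :: l).getD (j + 1) 0 ∧
        (a :: l).getD (j + 2) 0 < (a :: l).getD (j + 1) 0 then 1 else 0) = peakCount a l := by
  induction l generalizing a with
  | nil => simp [peakCount]
  | cons b l ih =>
    cases l with
    | nil => simp [peakCount]
    | cons c l =>
      have := ih b
      simp only [List.length_cons, Nat.add_sub_cancel] at this ⊢
      rw [Finset.sum_range_succ', peakCount, ← this, add_comm]
      simp

theorem lpk_two (l : List ℕ) : lpk 2 l = peakCount 0 l := by
  rw [← sum_peaks_eq_peakCount, lpk, Finset.card_filter, Finset.range_eq_Ico,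
    show l.length + 1 - 2 = l.length - 1 by omega, ← Finset.Ico_add_one_right_eq_Icc,
    ← Finset.sum_Ico_add' _ 0 (l.length - 1) 1]
  refine Finset.sum_congr rfl fun j _ => ?_
  simp [IsPeakAt, entry]

/-- A preceding letter that is at least as large as every letter prevents a peak in first position.
Interior and left peaks thus differ only in the initial letter of one recursive count. -/
theorem ipk_two {a : ℕ} (l : List ℕ) (h : ∀ b ∈ l, b ≤ a) : ipk 2 l = peakCount a l := by
  cases l with
  | nil => simp [ipk, peakCount]
  | cons b l =>
    rw [peakCount_of_le (h b (by simp)), ← sum_peaks_eq_peakCount, ipk, Finset.card_filter,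
      Finset.range_eq_Ico, ← Finset.Ico_add_one_right_eq_Icc]
    -- For a one-letter word `l.length - 1` is truncated and the endpoints disagree, but both sums
    -- are empty.
    have : (b :: l).length + 1 - 2 + 1 = l.length - 1 + 2 ∨
        (l.length = 0) := by simp only [List.length_cons]; omega
    rcases this with h1 | h1
    · rw [h1, ← Finset.sum_Ico_add' _ 0 (l.length - 1) 2]
      refine Finset.sum_congr rfl fun j _ => ?_
      simp [IsPeakAt, entry]
    · simp [h1]

/-- The word obtained from `l` by inserting `p, q` after the first `i` letters. -/
def insertPair (p q : ℕ) (l : List ℕ) (i : ℕ) : List ℕ := l.take i ++ p :: q :: l.drop i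

/-- The letter `p` always becomes a peak. The two slots next to an old peak destroy that peak, so
the count stays the same; peaks are never adjacent, so there are twice as many such slots as peaks.
Every other slot raises the count by one. -/
theorem sum_insertPair {p q : ℕ} (hqp : q < p) (l : List ℕ) (hl : ∀ b ∈ l, b < q) {a : ℕ}
    (ha : a < q) :
    ∑ i ∈ Finset.range (l.length + 1), (X : ℝ[X]) ^ peakCount a (insertPair p q l i) =
      2 * (peakCount a l : ℝ[X]) * X ^ peakCount a l +
        ((l.length : ℝ[X]) + 1 - 2 * (peakCount a l : ℝ[X])) * X ^ (peakCount a l + 1) := by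
  have key : ∀ (a b : ℕ) (l : List ℕ), a < q → b < q →
      peakCount a (insertPair p q (b :: l) 0) = peakCount b l + 1 := by
    intro a b l ha hb
    simp only [insertPair, List.take_zero, List.nil_append, List.drop_zero, peakCount]
    rw [if_pos (by omega), if_neg (by omega), peakCount_of_le hb.le]
    ring
  induction l generalizing a with
  | nil => simp [insertPair, peakCount, ha.trans hqp, hqp]
  | cons b l ih =>
    have hb : b < q := hl b (by simp)
    have ih := @ih (fun c hc => hl c (by simp [hc])) b hb
    cases l with
    | nil =>
      rw [List.length_cons, Finset.sum_range_succ', key a b [] ha hb]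
      simp [insertPair, peakCount, hqp, hb.trans hqp, (hb.trans hqp).not_gt]
      ring
    | cons c l =>
      have hc : c < q := hl c (by simp)
      rw [List.length_cons, Finset.sum_range_succ', key b c l hb hc] at ih
      rw [List.length_cons, Finset.sum_range_succ', key a b _ ha hb, List.length_cons,
        Finset.sum_range_succ']
      -- Directly after `b` the larger letter `p` follows, so `b` is no peak; in later slots the
      -- status of `b` is unaffected.
      have h1 : peakCount a (insertPair p q (b :: c :: l) (0 + 1)) = peakCount c l + 1 := by
        rw [← key b c l hb hc]
        simp only [insertPair, zero_add, List.take_succ_cons, List.take_zero, List.drop_succ_cons,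
          List.drop_zero, List.cons_append, List.nil_append]
        rw [peakCount, if_neg (by omega), zero_add]
      have h2 : ∀ i, peakCount a (insertPair p q (b :: c :: l) (i + 1 + 1)) =
          (if a < b ∧ c < b then 1 else 0) + peakCount b (insertPair p q (c :: l) (i + 1)) := by
        intro i
        simp only [insertPair, List.take_succ_cons, List.drop_succ_cons, List.cons_append, peakCount]
      simp only [h1, h2, peakCount]
      split_ifs with hpk
      · rw [peakCount_of_le hpk.2.le] at ih ⊢
        simp only [pow_add, pow_one, ← Finset.mul_sum] at ih ⊢
        push_cast at ih ⊢
        linear_combination X * ih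
      · simp only [zero_add]
        push_cast at ih ⊢
        linear_combination ih

/-- In the slot in front, `p` is no peak, so one more slot leaves the count unchanged; the other
slots fall under `sum_insertPair`. -/
theorem sum_insertPair_of_le {p q : ℕ} (hqp : q < p) (l : List ℕ) (hl : ∀ b ∈ l, b < q) {a : ℕ}
    (ha : p ≤ a) :
    ∑ i ∈ Finset.range (l.length + 1), (X : ℝ[X]) ^ peakCount a (insertPair p q l i) =
      (2 * (peakCount a l : ℝ[X]) + 1) * X ^ peakCount a l +
        ((l.length : ℝ[X]) - 2 * (peakCount a l : ℝ[X])) * X ^ (peakCount a l + 1) := by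
  cases l with
  | nil => simp [insertPair, peakCount, ha.not_gt]
  | cons b l =>
    have hb : b < q := hl b (by simp)
    have h := sum_insertPair hqp l (fun c hc => hl c (by simp [hc])) hb
    rw [List.length_cons, Finset.sum_range_succ', peakCount_of_le (by omega : b ≤ a)]
    have h1 : ∀ i, peakCount a (insertPair p q (b :: l) (i + 1)) =
        peakCount b (insertPair p q l i) := by
      intro i
      simp only [insertPair, List.take_succ_cons, List.drop_succ_cons, List.cons_append]
      exact peakCount_of_le (by omega) _
    have h2 : peakCount a (insertPair p q (b :: l) 0) = peakCount b l := by
      simp only [insertPair, List.take_zero, List.drop_zero, List.nil_append]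
      rw [peakCount_of_le ha, peakCount_of_le hqp.le, peakCount_of_le hb.le]
    simp only [h1, h2, h]
    push_cast
    ring

/-! ### Generating dual Stirling permutations by insertion. -/

theorem stirlingPerms_condition_iff {w : List ℕ} :
    (∀ l < w.length, ∀ s < l, ∀ k < s, w.getD k 0 = w.getD l 0 → w.getD k 0 ≤ w.getD s 0) ↔
      ∀ a b, [a, b, a].Sublist w → a ≤ b := by
  constructor
  · intro h a b hab
    obtain ⟨f, hf⟩ := List.sublist_iff_exists_fin_orderEmbedding_get_eq.1 hab
    have h0 := hf ⟨0, by simp⟩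
    have h1 := hf ⟨1, by simp⟩
    have h2 := hf ⟨2, by simp⟩
    have := h (f ⟨2, by simp⟩) (f ⟨2, by simp⟩).2 (f ⟨1, by simp⟩) (f.strictMono (by simp))
      (f ⟨0, by simp⟩) (f.strictMono (by simp))
    simp only [List.getD_eq_getElem _ _ (Fin.is_lt _)] at this
    simp only [List.get_eq_getElem] at h0 h1 h2
    rw [← h0, ← h1, ← h2] at this
    simpa using this
  · intro h l hl s hs k hk hkl
    refine h _ _ ?_
    have hd : w = w.take k ++ w.drop k := (List.take_append_drop k w).symm
    have e1 : w.drop k = w.getD k 0 :: w.drop (k + 1) := by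
      rw [List.getD_eq_getElem _ _ (by omega)]; exact List.drop_eq_getElem_cons (by omega)
    have e2 : w.drop s = w.getD s 0 :: w.drop (s + 1) := by
      rw [List.getD_eq_getElem _ _ (by omega)]; exact List.drop_eq_getElem_cons (by omega)
    have e3 : w.drop l = w.getD l 0 :: w.drop (l + 1) := by
      rw [List.getD_eq_getElem _ _ (by omega)]; exact List.drop_eq_getElem_cons (by omega)
    have s3 : [w.getD k 0].Sublist (w.drop (s + 1)) := by
      rw [hkl]
      refine List.Sublist.trans ?_ (List.drop_sublist_drop_left w (show s + 1 ≤ l by omega))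
      rw [e3]
      exact List.singleton_sublist.2 (by simp)
    have s2 : [w.getD s 0, w.getD k 0].Sublist (w.drop (k + 1)) := by
      refine List.Sublist.trans ?_ (List.drop_sublist_drop_left w (show k + 1 ≤ s by omega))
      rw [e2]
      exact s3.cons_cons _
    have s1 : [w.getD k 0, w.getD s 0, w.getD k 0].Sublist (w.drop k) := by
      conv_rhs => rw [e1]
      exact s2.cons_cons _
    exact s1.trans (List.drop_sublist k w)

theorem mem_stirlingPerms {n r : ℕ} {w : List ℕ} :
    w ∈ stirlingPerms n r ↔ (w : Multiset ℕ) = r • (Finset.Icc 1 n).val ∧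
      ∀ a b, [a, b, a].Sublist w → a ≤ b := by
  rw [stirlingPerms, Finset.mem_filter, stirlingPerms_condition_iff, Multiset.mem_toFinset,
    Multiset.mem_lists_iff]
  exact and_congr_left fun _ => eq_comm

theorem smul_Icc_succ (r n : ℕ) : r • (Finset.Icc 1 (n + 1)).val =
    r • (Finset.Icc 1 n).val + Multiset.replicate r (n + 1) := by
  rw [← Finset.insert_Icc_right_eq_Icc_add_one (by omega), Finset.insert_val_of_notMem (by simp),
    ← Multiset.singleton_add, smul_add, add_comm, Multiset.nsmul_singleton]

/-- A letter between the two copies of the maximum would have to be at least as large, hence a third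
copy. Conversely, a pattern `a b a` avoiding the maximum survives its deletion. -/
theorem mem_stirlingPerms_succ {n : ℕ} {w : List ℕ} :
    w ∈ stirlingPerms (n + 1) 2 ↔
      ∃ u v : List ℕ, u ++ v ∈ stirlingPerms n 2 ∧ w = u ++ (n + 1) :: (n + 1) :: v := by
  have hmem : ∀ {l : List ℕ}, (l : Multiset ℕ) = 2 • (Finset.Icc 1 n).val → ∀ x ∈ l, x ≤ n := by
    intro l hl x hx
    rw [← Multiset.mem_coe, hl, Multiset.mem_nsmul] at hx
    have := hx.2
    simp at this
    omega
  have hperm : ∀ u v : List ℕ, ((u ++ (n + 1) :: (n + 1) :: v : List ℕ) : Multiset ℕ) =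
      2 • (Finset.Icc 1 (n + 1)).val ↔ ((u ++ v : List ℕ) : Multiset ℕ) = 2 • (Finset.Icc 1 n).val := by
    intro u v
    rw [smul_Icc_succ, ← add_left_inj (Multiset.replicate 2 (n + 1)) (b := ((u ++ v : List ℕ) : Multiset ℕ))]
    have : ((u ++ (n + 1) :: (n + 1) :: v : List ℕ) : Multiset ℕ) =
        ((u ++ v : List ℕ) : Multiset ℕ) + Multiset.replicate 2 (n + 1) := by
      rw [← Multiset.coe_replicate, Multiset.coe_add, Multiset.coe_eq_coe,
        List.perm_iff_count]
      intro a
      simp [List.count_cons]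
      split_ifs <;> omega
    rw [this]
  simp only [mem_stirlingPerms]
  constructor
  · rintro ⟨hw, hs⟩
    have hcount : w.count (n + 1) = 2 := by
      rw [← Multiset.coe_count, hw, smul_Icc_succ, Multiset.count_add, Multiset.count_nsmul]
      simp
    have hle : ∀ x ∈ w, x ≤ n + 1 := by
      intro x hx
      rw [← Multiset.mem_coe, hw, Multiset.mem_nsmul] at hx
      have := hx.2
      simp at this
      omega
    obtain ⟨u, y, rfl, hu⟩ := List.eq_append_cons_of_mem
      (List.count_pos_iff.1 (by omega : 0 < w.count (n + 1)))
    have hy : y.count (n + 1) = 1 := by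
      simpa [List.count_eq_zero.2 hu] using hcount
    obtain ⟨x, v, rfl, hx⟩ := List.eq_append_cons_of_mem
      (List.count_pos_iff.1 (by omega : 0 < y.count (n + 1)))
    have hx0 : x = [] := by
      rw [List.eq_nil_iff_forall_not_mem]
      intro b hb
      have h1 : n + 1 ≤ b := by
        refine hs _ _ (List.Sublist.trans ?_ (List.sublist_append_right u _))
        refine List.Sublist.cons_cons _ ?_
        exact (List.singleton_sublist.2 hb).append (List.singleton_sublist.2 (by simp))
      have h2 := hle b (by simp [hb])
      exact hx (by rwa [show n + 1 = b by omega])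
    subst hx0
    rw [List.nil_append] at hw hs ⊢
    exact ⟨u, v, ⟨(hperm u v).1 hw, fun a b hab => hs a b (hab.trans
      ((List.Sublist.refl u).append (List.sublist_append_right [n + 1, n + 1] v)))⟩, rfl⟩
  · rintro ⟨u, v, ⟨hw, hs⟩, rfl⟩
    refine ⟨(hperm u v).2 hw, fun a b hab => ?_⟩
    have hle := hmem hw
    by_cases hb : b = n + 1
    · subst hb
      have : a ∈ u ++ (n + 1) :: (n + 1) :: v := hab.subset (by simp)
      simp only [List.mem_append, List.mem_cons] at this
      rcases this with h | h | h | h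
      · exact (hle a (by simp [h])).trans (Nat.le_succ n)
      · exact h.le
      · exact h.le
      · exact (hle a (by simp [h])).trans (Nat.le_succ n)
    by_cases ha : a = n + 1
    · subst ha
      exfalso
      have hu : n + 1 ∉ u := fun h => by have := hle _ (List.mem_append_left v h); omega
      have hv : n + 1 ∉ v := fun h => by have := hle _ (List.mem_append_right u h); omega
      -- Both occurrences of `n + 1` must come from the adjacent pair, which leaves no room for `b ≠
      -- n + 1`.
      obtain ⟨l₁, l₂, h12, h1, h2⟩ := List.sublist_append_iff.1 hab
      cases l₁ with
      | cons x l₁ =>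
        simp only [List.cons_append, List.cons.injEq] at h12
        exact hu (h1.subset (by simp [h12.1]))
      | nil =>
        rw [List.nil_append] at h12
        subst h12
        rw [List.cons_sublist_cons, List.sublist_cons_iff] at h2
        rcases h2 with h2 | ⟨r, hr, -⟩
        · exact hv (h2.subset (by simp))
        · simp only [List.cons.injEq] at hr
          exact hb hr.1
    · refine hs a b ?_
      have h := hab.filter (fun x => x ≠ n + 1)
      have e : ∀ l : List ℕ, (∀ x ∈ l, x ≤ n) → l.filter (fun x => x ≠ n + 1) = l := by
        intro l hl
        rw [List.filter_eq_self]
        intro x hx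
        have := hl x hx
        simp; omega
      have e1 := e u fun x hx => hle x (by simp [hx])
      have e2 := e v fun x hx => hle x (by simp [hx])
      have e3 : ((n + 1) :: (n + 1) :: v).filter (fun x => x ≠ n + 1) = v := by
        rw [List.filter_cons_of_neg (by simp), List.filter_cons_of_neg (by simp), e2]
      rw [List.filter_append, e1, e3] at h
      simpa [List.filter_cons, ha, hb] using h

/-- The new pair changes no occurrence count of another letter; it only shifts positions after it by
two. -/
theorem dualWord_insert {N : ℕ} {u v : List ℕ} (hu : N ∉ u) (hv : N ∉ v) :
    dualWord 2 (u ++ N :: N :: v) =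
      insertPair (2 * N) (2 * N - 1) (dualWord 2 (u ++ v)) u.length := by
  have h : dualWord 2 (u ++ v) = dualWord 2 u ++
      v.mapIdx fun i a => 2 * a + 1 - ((u ++ v).take (i + u.length + 1)).count a := by
    rw [dualWord, List.mapIdx_append]
    congr 1
    rw [dualWord, List.mapIdx_eq_mapIdx_iff]
    intro i hi
    rw [List.take_append_of_le_length (by omega)]
  have hl : (dualWord 2 u).length = u.length := by simp [dualWord]
  rw [insertPair, h, ← hl, List.take_left, List.drop_left, hl]
  rw [dualWord, List.mapIdx_append, List.mapIdx_cons, List.mapIdx_cons]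
  congr 1
  · rw [dualWord, List.mapIdx_eq_mapIdx_iff]
    intro i hi
    rw [List.take_append_of_le_length (by omega)]
  · congr 1
    · rw [List.take_append, List.take_of_length_le (by omega),
        show 0 + u.length + 1 - u.length = 1 by omega]
      simp [List.count_eq_zero.2 hu]
    congr 1
    · rw [List.take_append, List.take_of_length_le (by omega),
        show 0 + 1 + u.length + 1 - u.length = 2 by omega]
      simp [List.count_eq_zero.2 hu]
    · rw [List.mapIdx_eq_mapIdx_iff]
      intro i hi
      have hne : N ≠ v[i] := fun h => hv (h ▸ List.getElem_mem hi)
      have e1 : (u ++ N :: N :: v).take (i + 1 + 1 + u.length + 1) =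
          u ++ N :: N :: v.take (i + 1) := by
        rw [List.take_append, List.take_of_length_le (by omega)]
        congr 1
        rw [show i + 1 + 1 + u.length + 1 - u.length = i + 1 + 1 + 1 by omega]
        simp
      have e2 : (u ++ v).take (i + u.length + 1) = u ++ v.take (i + 1) := by
        rw [List.take_append, List.take_of_length_le (by omega)]
        congr 2
        omega
      rw [e1, e2]
      simp [hne]

theorem length_of_mem_stirlingPerms {n r : ℕ} {w : List ℕ} (h : w ∈ stirlingPerms n r) :
    w.length = r * n := by
  rw [← Multiset.coe_card, (mem_stirlingPerms.1 h).1]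
  simp

theorem le_of_mem_stirlingPerms {n r : ℕ} {w : List ℕ} (h : w ∈ stirlingPerms n r) {x : ℕ}
    (hx : x ∈ w) : x ≤ n := by
  rw [← Multiset.mem_coe, (mem_stirlingPerms.1 h).1, Multiset.mem_nsmul] at hx
  exact (Finset.mem_Icc.1 hx.2).2

theorem length_of_mem_dualStirlingPerms {n r : ℕ} {π : List ℕ} (h : π ∈ dualStirlingPerms n r) :
    π.length = r * n := by
  obtain ⟨w, hw, rfl⟩ := Finset.mem_image.1 h
  rw [dualWord, List.length_mapIdx, length_of_mem_stirlingPerms hw]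

theorem le_of_mem_dualStirlingPerms {n r : ℕ} {π : List ℕ} (h : π ∈ dualStirlingPerms n r) {x : ℕ}
    (hx : x ∈ π) : x ≤ r * n := by
  obtain ⟨w, hw, rfl⟩ := Finset.mem_image.1 h
  rw [dualWord, List.mem_mapIdx] at hx
  obtain ⟨i, hi, rfl⟩ := hx
  have h1 : w[i] ≤ n := le_of_mem_stirlingPerms hw (List.getElem_mem hi)
  have h2 : 0 < (w.take (i + 1)).count w[i] :=
    List.count_pos_iff.2 (List.mem_take_iff_getElem.2 ⟨i, by omega, rfl⟩)
  have := Nat.mul_le_mul_left r h1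
  omega

theorem dualStirlingPerms_succ (n : ℕ) : dualStirlingPerms (n + 1) 2 =
    (dualStirlingPerms n 2 ×ˢ Finset.range (2 * n + 1)).image fun x =>
      insertPair (2 * (n + 1)) (2 * (n + 1) - 1) x.1 x.2 := by
  ext π
  simp only [dualStirlingPerms, Finset.mem_image, Finset.mem_product, mem_stirlingPerms_succ,
    Prod.exists, Finset.mem_range]
  constructor
  · rintro ⟨_, ⟨u, v, h, rfl⟩, rfl⟩
    have hle : ∀ x ∈ u ++ v, x ≤ n := fun x hx => le_of_mem_stirlingPerms h hx
    have hl := length_of_mem_stirlingPerms h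
    rw [List.length_append] at hl
    refine ⟨_, u.length, ⟨⟨_, h, rfl⟩, by omega⟩, ?_⟩
    rw [dualWord_insert]
    · intro hx; have := hle _ (List.mem_append_left v hx); omega
    · intro hx; have := hle _ (List.mem_append_right u hx); omega
  · rintro ⟨_, i, ⟨⟨w, h, rfl⟩, hi⟩, rfl⟩
    have hle : ∀ x ∈ w, x ≤ n := fun x hx => le_of_mem_stirlingPerms h hx
    have hl := length_of_mem_stirlingPerms h
    refine ⟨_, ⟨w.take i, w.drop i, by rwa [List.take_append_drop], rfl⟩, ?_⟩
    rw [dualWord_insert, List.take_append_drop, List.length_take, min_eq_left (by omega)]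
    · intro hx; have := hle _ (List.mem_of_mem_take hx); omega
    · intro hx; have := hle _ (List.mem_of_mem_drop hx); omega

/-- The word is recovered by keeping the letters below `q`, and the slot as the position of `p`.
Working with insertions into dual words makes injectivity of `dualWord` unnecessary. -/
theorem insertPair_injOn {p q : ℕ} (hqp : q < p) {l l' : List ℕ} (hl : ∀ x ∈ l, x < q)
    (hl' : ∀ x ∈ l', x < q) {i j : ℕ} (hi : i ≤ l.length) (hj : j ≤ l'.length)
    (h : insertPair p q l i = insertPair p q l' j) : l = l' ∧ i = j := by
  have e : ∀ l : List ℕ, (∀ x ∈ l, x < q) → ∀ i, (insertPair p q l i).filter (· < q) = l := by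
    intro l hl i
    have h1 : (l.take i).filter (· < q) = l.take i :=
      List.filter_eq_self.2 fun x hx => by simpa using hl x (List.mem_of_mem_take hx)
    have h2 : (l.drop i).filter (· < q) = l.drop i :=
      List.filter_eq_self.2 fun x hx => by simpa using hl x (List.mem_of_mem_drop hx)
    rw [insertPair, List.filter_append, List.filter_cons_of_neg (by simpa using hqp.le),
      List.filter_cons_of_neg (by simp), h1, h2, List.take_append_drop]
  have e' : ∀ l : List ℕ, (∀ x ∈ l, x < q) → ∀ i ≤ l.length,
      (insertPair p q l i).idxOf p = i := by
    intro l hl i hi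
    rw [insertPair, List.idxOf_append_of_notMem, List.idxOf_cons_self, List.length_take,
      min_eq_left hi, add_zero]
    intro hx
    exact absurd (hl p (List.mem_of_mem_take hx)) (by omega)
  exact ⟨by rw [← e l hl i, h, e l' hl' j], by rw [← e' l hl i hi, h, e' l' hl' j hj]⟩

theorem sum_dualStirlingPerms_succ (n : ℕ) (f : List ℕ → ℝ[X]) :
    ∑ π ∈ dualStirlingPerms (n + 1) 2, f π = ∑ π ∈ dualStirlingPerms n 2,
      ∑ i ∈ Finset.range (π.length + 1),
        f (insertPair (2 * (n + 1)) (2 * (n + 1) - 1) π i) := by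
  rw [dualStirlingPerms_succ, Finset.sum_image, Finset.sum_product]
  · refine Finset.sum_congr rfl fun π hπ => ?_
    rw [length_of_mem_dualStirlingPerms hπ]
  · rintro ⟨π, i⟩ h ⟨π', j⟩ h' hij
    simp only [Finset.coe_product, Set.mem_prod, Finset.mem_coe, Finset.mem_range] at h h'
    have := insertPair_injOn (by omega)
      (fun x hx => by have := le_of_mem_dualStirlingPerms h.1 hx; omega)
      (fun x hx => by have := le_of_mem_dualStirlingPerms h'.1 hx; omega)
      (by rw [length_of_mem_dualStirlingPerms h.1]; omega)
      (by rw [length_of_mem_dualStirlingPerms h'.1]; omega) hij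
    exact Prod.ext this.1 this.2

/-! ### Recurrences for the peak polynomials. -/

theorem X_mul_derivative_X_pow (k : ℕ) :
    (X : ℝ[X]) * derivative (X ^ k) = (k : ℝ[X]) * X ^ k := by
  cases k with
  | zero => simp
  | succ k => rw [derivative_X_pow_succ]; simp; ring

/-- A word of length `2n` with `k` peaks contributes `2k x^k + (2n+1-2k) x^(k+1) = (2n+1) x · x^k +
2(1-x) · k x^k`, and `k x^k` is `x` times the derivative of `x^k`. -/
theorem leftPeakPoly_succ (n : ℕ) : leftPeakPoly (n + 1) 2 =
    (2 * (n : ℝ[X]) + 1) * X * leftPeakPoly n 2 +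
      2 * X * (1 - X) * derivative (leftPeakPoly n 2) := by
  rw [leftPeakPoly, sum_dualStirlingPerms_succ, leftPeakPoly, derivative_sum, Finset.mul_sum,
    Finset.mul_sum, ← Finset.sum_add_distrib]
  refine Finset.sum_congr rfl fun π hπ => ?_
  simp only [lpk_two]
  rw [sum_insertPair (p := 2 * (n + 1)) (q := 2 * (n + 1) - 1) (by omega)
    π (fun x hx => by have := le_of_mem_dualStirlingPerms hπ hx; omega) (by omega),
    length_of_mem_dualStirlingPerms hπ]
  push_cast
  linear_combination (-2 * (1 - X)) * X_mul_derivative_X_pow (peakCount 0 π)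

theorem interiorPeakPoly_succ (n : ℕ) : interiorPeakPoly (n + 1) 2 =
    (1 + 2 * (n : ℝ[X]) * X) * interiorPeakPoly n 2 +
      2 * X * (1 - X) * derivative (interiorPeakPoly n 2) := by
  rw [interiorPeakPoly, sum_dualStirlingPerms_succ, interiorPeakPoly, derivative_sum,
    Finset.mul_sum, Finset.mul_sum, ← Finset.sum_add_distrib]
  refine Finset.sum_congr rfl fun π hπ => ?_
  have hle : ∀ x ∈ π, x < 2 * (n + 1) - 1 :=
    fun x hx => by have := le_of_mem_dualStirlingPerms hπ hx; omega
  have h1 : ∀ i, ipk 2 (insertPair (2 * (n + 1)) (2 * (n + 1) - 1) π i) =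
      peakCount (2 * (n + 1)) (insertPair (2 * (n + 1)) (2 * (n + 1) - 1) π i) := by
    refine fun i => ipk_two _ fun b hb => ?_
    simp only [insertPair, List.mem_append, List.mem_cons] at hb
    rcases hb with h | h | h | h
    · have := hle b (List.mem_of_mem_take h); omega
    · omega
    · omega
    · have := hle b (List.mem_of_mem_drop h); omega
  simp only [h1, ipk_two (a := 2 * (n + 1)) π fun x hx => by have := hle x hx; omega]
  rw [sum_insertPair_of_le (by omega) π hle le_rfl, length_of_mem_dualStirlingPerms hπ]
  push_cast
  linear_combination (-2 * (1 - X)) * X_mul_derivative_X_pow (peakCount (2 * (n + 1)) π)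

theorem dualStirlingPerms_zero (r : ℕ) : dualStirlingPerms 0 r = {[]} := by
  have : stirlingPerms 0 r = {[]} := by
    ext w
    rw [mem_stirlingPerms]
    simp +contextual
  rw [dualStirlingPerms, this]
  rfl

theorem leftPeakPoly_zero : leftPeakPoly 0 2 = 1 := by
  simp [leftPeakPoly, dualStirlingPerms_zero, lpk_two, peakCount]

theorem interiorPeakPoly_zero : interiorPeakPoly 0 2 = 1 := by
  simp [interiorPeakPoly, dualStirlingPerms_zero, ipk_two (a := 0) [], peakCount]

/-! ### The palindromic pair `(b, c)` and its coefficients. -/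

/-- The polynomials `b` and `c` for which `X * (b (X ^ 2) + X * c (X ^ 2))` is `Tₘ₊₁,₂`. -/
noncomputable def peakHalves : ℕ → ℝ[X] × ℝ[X]
  | 0 => (1, 0)
  | m + 1 =>
    ((1 - X) * ((peakHalves m).1 + 2 * X * derivative (peakHalves m).1) + X * (peakHalves m).2 +
        2 * ((m : ℝ[X]) + 1) * X * (peakHalves m).1,
      2 * (1 - X) * ((peakHalves m).2 + X * derivative (peakHalves m).2) +
        2 * ((m : ℝ[X]) + 1) * X * (peakHalves m).2 + (peakHalves m).1)

theorem interiorPeakPoly_eq_peakHalves (m : ℕ) :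
    interiorPeakPoly (m + 1) 2 = (peakHalves m).1 + X * (peakHalves m).2 := by
  induction m with
  | zero => simp [interiorPeakPoly_succ, interiorPeakPoly_zero, peakHalves]
  | succ m ih =>
    rw [interiorPeakPoly_succ, ih, peakHalves]
    simp only [derivative_add, derivative_mul, derivative_X]
    push_cast
    ring

theorem leftPeakPoly_eq_peakHalves (m : ℕ) :
    leftPeakPoly (m + 1) 2 = X * ((peakHalves m).1 + (peakHalves m).2) := by
  induction m with
  | zero => simp [leftPeakPoly_succ, leftPeakPoly_zero, peakHalves]
  | succ m ih =>
    rw [leftPeakPoly_succ, ih, peakHalves]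
    simp only [derivative_add, derivative_mul, derivative_X]
    push_cast
    ring

theorem coeff_natCast_mul' (n : ℕ) (p : ℝ[X]) (k : ℕ) :
    ((n : ℝ[X]) * p).coeff k = n * p.coeff k := by
  rw [← C_eq_natCast, coeff_C_mul]

theorem coeff_X_mul_derivative (p : ℝ[X]) (k : ℕ) :
    (X * derivative p).coeff k = k * p.coeff k := by
  cases k with
  | zero => simp
  | succ k => rw [coeff_X_mul, coeff_derivative]; push_cast; ring

theorem coeff_zero_peakHalves_succ (m : ℕ) :
    (peakHalves (m + 1)).1.coeff 0 = (peakHalves m).1.coeff 0 ∧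
    (peakHalves (m + 1)).2.coeff 0 = 2 * (peakHalves m).2.coeff 0 + (peakHalves m).1.coeff 0 := by
  constructor <;> simp [peakHalves, mul_coeff_zero]

theorem coeff_succ_peakHalves_succ (m k : ℕ) :
    (peakHalves (m + 1)).1.coeff (k + 1) = (2 * k + 3) * (peakHalves m).1.coeff (k + 1) +
      (2 * m + 1 - 2 * k) * (peakHalves m).1.coeff k + (peakHalves m).2.coeff k ∧
    (peakHalves (m + 1)).2.coeff (k + 1) = (2 * k + 4) * (peakHalves m).2.coeff (k + 1) +
      (2 * m - 2 * k) * (peakHalves m).2.coeff k + (peakHalves m).1.coeff (k + 1) := by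
  have e1 : (peakHalves (m + 1)).1 = (peakHalves m).1 +
      ((2 : ℕ) : ℝ[X]) * (X * derivative (peakHalves m).1) + X * (-(peakHalves m).1 -
        ((2 : ℕ) : ℝ[X]) * (X * derivative (peakHalves m).1) + (peakHalves m).2 +
          ((2 * (m + 1) : ℕ) : ℝ[X]) * (peakHalves m).1) := by
    rw [peakHalves]; push_cast; ring
  have e2 : (peakHalves (m + 1)).2 = (peakHalves m).1 + ((2 : ℕ) : ℝ[X]) * (peakHalves m).2 +
      ((2 : ℕ) : ℝ[X]) * (X * derivative (peakHalves m).2) + X * (-(((2 : ℕ) : ℝ[X]) * (peakHalves m).2) -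
        ((2 : ℕ) : ℝ[X]) * (X * derivative (peakHalves m).2) + ((2 * (m + 1) : ℕ) : ℝ[X]) * (peakHalves m).2) := by
    rw [peakHalves]; push_cast; ring
  constructor
  · rw [e1, coeff_add, coeff_X_mul]
    simp only [coeff_add, coeff_sub, coeff_neg, coeff_natCast_mul', coeff_X_mul_derivative]
    push_cast
    ring
  · rw [e2, coeff_add, coeff_X_mul]
    simp only [coeff_add, coeff_sub, coeff_neg, coeff_natCast_mul', coeff_X_mul_derivative]
    push_cast
    ring

theorem peakHalves_fst_coeff_zero (m : ℕ) : (peakHalves m).1.coeff 0 = 1 := by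
  induction m with
  | zero => simp [peakHalves]
  | succ m ih => rw [(coeff_zero_peakHalves_succ m).1, ih]

theorem peakHalves_coeff_eq_zero (m : ℕ) :
    (∀ k, m < k → (peakHalves m).1.coeff k = 0) ∧ (∀ k, m ≤ k → (peakHalves m).2.coeff k = 0) := by
  induction m with
  | zero =>
    refine ⟨fun k hk => ?_, fun k _ => by simp [peakHalves]⟩
    simp [peakHalves, coeff_one, hk.ne']
  | succ m ih =>
    refine ⟨fun k hk => ?_, fun k hk => ?_⟩ <;> obtain ⟨k, rfl⟩ : ∃ j, k = j + 1 :=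
      ⟨k - 1, by omega⟩
    · rw [(coeff_succ_peakHalves_succ m k).1, ih.1 _ (by omega), ih.1 _ (by omega),
        ih.2 _ (by omega)]
      ring
    · rw [(coeff_succ_peakHalves_succ m k).2, ih.1 _ (by omega), ih.2 _ (by omega),
        ih.2 _ (by omega)]
      ring

/-- Reversing the index exchanges the factors `2k+3` and `2m+1-2k` in the recurrence for `b`, and
`2k+4` and `2m-2k` in that for `c`. The end coefficients are compared separately. -/
theorem peakHalves_coeff_symm (m : ℕ) :
    (∀ i j, i + j = m → (peakHalves m).1.coeff i = (peakHalves m).1.coeff j) ∧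
    (∀ i j, i + j + 1 = m → (peakHalves m).2.coeff i = (peakHalves m).2.coeff j) := by
  induction m with
  | zero =>
    refine ⟨fun i j h => ?_, fun i j h => by omega⟩
    rw [show i = j by omega]
  | succ m ih =>
    obtain ⟨v1, v2⟩ := peakHalves_coeff_eq_zero m
    have h1 : (peakHalves (m + 1)).1.coeff (m + 1) = (peakHalves (m + 1)).1.coeff 0 := by
      rw [(coeff_succ_peakHalves_succ m m).1, (coeff_zero_peakHalves_succ m).1, v1 _ (by omega),
        v2 _ le_rfl, ih.1 m 0 (by omega)]
      ring
    have h2 : (peakHalves (m + 1)).2.coeff m = (peakHalves (m + 1)).2.coeff 0 := by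
      cases m with
      | zero => rfl
      | succ m =>
        rw [(coeff_succ_peakHalves_succ _ m).2, (coeff_zero_peakHalves_succ _).2, v2 _ le_rfl,
          ih.1 (m + 1) 0 (by omega), ih.2 m 0 (by omega)]
        push_cast
        ring
    constructor
    · rintro (_ | i) (_ | j) h
      · rfl
      · rw [show j = m by omega, h1]
      · rw [show i = m by omega, h1]
      · rw [(coeff_succ_peakHalves_succ m i).1, (coeff_succ_peakHalves_succ m j).1,
          ih.1 (i + 1) j (by omega), ih.1 i (j + 1) (by omega), ih.2 i j (by omega),
          show m = i + j + 1 by omega]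
        push_cast
        ring
    · rintro (_ | i) (_ | j) h
      · rfl
      · rw [show j + 1 = m by omega, h2]
      · rw [show i + 1 = m by omega, h2]
      · rw [(coeff_succ_peakHalves_succ m i).2, (coeff_succ_peakHalves_succ m j).2,
          ih.2 (i + 1) j (by omega), ih.2 i (j + 1) (by omega),
          ih.1 (i + 1) (j + 1) (by omega), show m = i + j + 2 by omega]
        push_cast
        ring

theorem peakHalves_coeff_nonneg (m : ℕ) :
    (∀ k, 0 ≤ (peakHalves m).1.coeff k) ∧ (∀ k, 0 ≤ (peakHalves m).2.coeff k) := by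
  induction m with
  | zero =>
    refine ⟨fun k => ?_, fun k => by simp [peakHalves]⟩
    simp only [peakHalves, coeff_one]
    split_ifs <;> norm_num
  | succ m ih =>
    obtain ⟨v1, v2⟩ := peakHalves_coeff_eq_zero (m + 1)
    obtain ⟨h1, h2⟩ := ih
    constructor
    · rintro (_ | k)
      · rw [(coeff_zero_peakHalves_succ m).1]; exact h1 0
      · rcases le_or_gt (k + 1) (m + 1) with hk | hk
        · rw [(coeff_succ_peakHalves_succ m k).1]
          have : (k : ℝ) ≤ m := by exact_mod_cast (by omega : k ≤ m)
          have := mul_nonneg (by linarith : (0 : ℝ) ≤ 2 * m + 1 - 2 * k) (h1 k)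
          have := mul_nonneg (by positivity : (0 : ℝ) ≤ 2 * k + 3) (h1 (k + 1))
          linarith [h2 k]
        · rw [v1 _ hk]
    · rintro (_ | k)
      · rw [(coeff_zero_peakHalves_succ m).2]; linarith [h1 0, h2 0]
      · rcases le_or_gt (m + 1) (k + 1) with hk | hk
        · rw [v2 _ hk]
        · rw [(coeff_succ_peakHalves_succ m k).2]
          have : (k : ℝ) ≤ m := by exact_mod_cast (by omega : k ≤ m)
          have := mul_nonneg (by linarith : (0 : ℝ) ≤ 2 * m - 2 * k) (h2 k)
          have := mul_nonneg (by positivity : (0 : ℝ) ≤ 2 * k + 4) (h2 (k + 1))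
          linarith [h1 (k + 1)]

theorem peakHalves_coeff_mono (m : ℕ) :
    (∀ k, 2 * k + 1 ≤ m → (peakHalves m).1.coeff k ≤ (peakHalves m).1.coeff (k + 1)) ∧
    (∀ k, 2 * k + 2 ≤ m → (peakHalves m).2.coeff k ≤ (peakHalves m).2.coeff (k + 1)) := by
  induction m with
  | zero => exact ⟨fun k hk => by omega, fun k hk => by omega⟩
  | succ m ih =>
    obtain ⟨s1, s2⟩ := peakHalves_coeff_symm m
    obtain ⟨n1, n2⟩ := peakHalves_coeff_nonneg m
    obtain ⟨h1, h2⟩ := ih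
    constructor
    · rintro (_ | k) hk
      · rw [(coeff_zero_peakHalves_succ m).1, (coeff_succ_peakHalves_succ m 0).1]
        have := mul_nonneg (Nat.cast_nonneg m : (0 : ℝ) ≤ m) (n1 0)
        push_cast
        linarith [n1 1, n2 0]
      · rw [(coeff_succ_peakHalves_succ m k).1, (coeff_succ_peakHalves_succ m (k + 1)).1]
        have d1 := h1 k (by omega)
        -- At the centre the step from `k + 1` to `k + 2` is not covered by induction, but symmetry
        -- makes the outer coefficients equal.
        have d2 : (peakHalves m).1.coeff k ≤ (peakHalves m).1.coeff (k + 1 + 1) := by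
          rcases eq_or_ne (2 * k + 2) m with h | h
          · exact (s1 _ _ (by omega)).le
          · exact d1.trans (h1 (k + 1) (by omega))
        have d3 := h2 k (by omega)
        have hm : 2 * (k : ℝ) + 2 ≤ m := by exact_mod_cast (by omega : 2 * k + 2 ≤ m)
        -- The difference equals `(2k+5)(b_{k+2} - b_k) + (2m-4k-4)(b_{k+1} - b_k) + (c_{k+1} -
        -- c_k)`; an analogous splitting serves for `c` below.
        have t1 := mul_nonneg (by linarith : (0 : ℝ) ≤ 2 * m - 4 * (k + 1)) (sub_nonneg.2 d1)
        have t2 := mul_nonneg (by positivity : (0 : ℝ) ≤ 2 * (k + 1) + 3) (sub_nonneg.2 d2)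
        push_cast
        linarith
    · rintro (_ | k) hk
      · rw [(coeff_zero_peakHalves_succ m).2, (coeff_succ_peakHalves_succ m 0).2]
        have hm : (1 : ℝ) ≤ m := by exact_mod_cast (by omega : 1 ≤ m)
        have := mul_nonneg (sub_nonneg.2 hm) (n2 0)
        push_cast
        linarith [n2 (0 + 1), h1 0 (by omega)]
      · rw [(coeff_succ_peakHalves_succ m k).2, (coeff_succ_peakHalves_succ m (k + 1)).2]
        have d1 := h2 k (by omega)
        have d2 : (peakHalves m).2.coeff k ≤ (peakHalves m).2.coeff (k + 1 + 1) := by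
          rcases eq_or_ne (2 * k + 3) m with h | h
          · exact (s2 _ _ (by omega)).le
          · exact d1.trans (h2 (k + 1) (by omega))
        have d3 := h1 (k + 1) (by omega)
        have hm : 2 * (k : ℝ) + 3 ≤ m := by exact_mod_cast (by omega : 2 * k + 3 ≤ m)
        have t1 := mul_nonneg (by linarith : (0 : ℝ) ≤ 2 * m - 4 * (k + 1) - 2) (sub_nonneg.2 d1)
        have t2 := mul_nonneg (by positivity : (0 : ℝ) ≤ 2 * (k + 1) + 4) (sub_nonneg.2 d2)
        push_cast
        linarith

theorem peakHalves_fst_coeff_self (m : ℕ) : (peakHalves m).1.coeff m = 1 := by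
  rw [(peakHalves_coeff_symm m).1 m 0 (by omega), peakHalves_fst_coeff_zero]

theorem peakHalves_fst_natDegree (m : ℕ) : (peakHalves m).1.natDegree = m :=
  natDegree_eq_of_le_of_coeff_ne_zero
    (natDegree_le_iff_coeff_eq_zero.2 fun k hk => (peakHalves_coeff_eq_zero m).1 k hk)
    (by rw [peakHalves_fst_coeff_self]; exact one_ne_zero)

theorem peakHalves_fst_monic (m : ℕ) : (peakHalves m).1.Monic := by
  rw [Monic, leadingCoeff, peakHalves_fst_natDegree, peakHalves_fst_coeff_self]

/-! ### Alternating increase. -/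

theorem alternatinglyIncreasing_interiorPeakPoly (n : ℕ) :
    AlternatinglyIncreasing (interiorPeakPoly n 2) := by
  rcases n with _ | m
  · rw [interiorPeakPoly_zero]
    simp [AlternatinglyIncreasing]
  obtain ⟨s1, s2⟩ := peakHalves_coeff_symm m
  obtain ⟨n1, n2⟩ := peakHalves_coeff_nonneg m
  obtain ⟨v1, v2⟩ := peakHalves_coeff_eq_zero m
  obtain ⟨m1, m2⟩ := peakHalves_coeff_mono m
  have hc : ∀ k, (interiorPeakPoly (m + 1) 2).coeff (k + 1) =
      (peakHalves m).1.coeff (k + 1) + (peakHalves m).2.coeff k := by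
    intro k; rw [interiorPeakPoly_eq_peakHalves, coeff_add, coeff_X_mul]
  have hc0 : (interiorPeakPoly (m + 1) 2).coeff 0 = 1 := by
    rw [interiorPeakPoly_eq_peakHalves]; simp [peakHalves_fst_coeff_zero]
  have hd : (interiorPeakPoly (m + 1) 2).natDegree = m := by
    refine natDegree_eq_of_le_of_coeff_ne_zero (natDegree_le_iff_coeff_eq_zero.2 ?_) (ne_of_gt ?_)
    · rintro (_ | k) hk
      · omega
      · rw [hc, v1 _ hk, v2 _ (by omega), add_zero]
    · have := peakHalves_fst_coeff_self m
      rcases m with _ | k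
      · rw [hc0]; exact one_pos
      · rw [hc]; linarith [n2 k]
  -- By symmetry `p_{m-i} = b_i + c_i`, while `p_i = b_i + c_{i-1}`; successive comparisons
  -- therefore involve only `c` or only `b`.
  have hr : ∀ i j, i + j = m → (interiorPeakPoly (m + 1) 2).coeff j =
      (peakHalves m).1.coeff i + (peakHalves m).2.coeff i := by
    rintro i (_ | j) h
    · rw [hc0, show i = m by omega, peakHalves_fst_coeff_self, v2 _ le_rfl, add_zero]
    · rw [hc, s1 i (j + 1) h, s2 i j (by omega)]
  refine ⟨by rw [hc0]; exact zero_le_one, fun i hi => ?_, fun i hi => ?_⟩ <;> rw [hd] at hi ⊢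
  · rw [hr i (m - i) (by omega)]
    rcases i with _ | k
    · rw [hc0, peakHalves_fst_coeff_zero]
      linarith [n2 0]
    · rw [hc]
      rcases eq_or_ne (2 * k + 2) m with h | h
      · rw [s2 k (k + 1) (by omega)]
      · linarith [m2 k (by omega)]
  · rw [hr i (m - i) (by omega), hc]
    linarith [m1 i (by omega)]

theorem alternatinglyIncreasing_leftPeakPoly (n : ℕ) :
    AlternatinglyIncreasing (leftPeakPoly n 2) := by
  rcases n with _ | m
  · rw [leftPeakPoly_zero]
    simp [AlternatinglyIncreasing]
  obtain ⟨s1, s2⟩ := peakHalves_coeff_symm m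
  obtain ⟨n1, n2⟩ := peakHalves_coeff_nonneg m
  obtain ⟨v1, v2⟩ := peakHalves_coeff_eq_zero m
  obtain ⟨m1, m2⟩ := peakHalves_coeff_mono m
  have hc : ∀ k, (leftPeakPoly (m + 1) 2).coeff (k + 1) =
      (peakHalves m).1.coeff k + (peakHalves m).2.coeff k := by
    intro k; rw [leftPeakPoly_eq_peakHalves, coeff_X_mul, coeff_add]
  have hc0 : (leftPeakPoly (m + 1) 2).coeff 0 = 0 := by
    rw [leftPeakPoly_eq_peakHalves]; simp
  have hd : (leftPeakPoly (m + 1) 2).natDegree = m + 1 := by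
    refine natDegree_eq_of_le_of_coeff_ne_zero (natDegree_le_iff_coeff_eq_zero.2 ?_) (ne_of_gt ?_)
    · rintro (_ | k) hk
      · omega
      · rw [hc, v1 _ (by omega), v2 _ (by omega), add_zero]
    · rw [hc, peakHalves_fst_coeff_self]
      linarith [n2 m]
  have hr0 : (leftPeakPoly (m + 1) 2).coeff (m + 1) = 1 := by
    rw [hc, peakHalves_fst_coeff_self, v2 _ le_rfl, add_zero]
  have hr : ∀ i j, i + j = m → (leftPeakPoly (m + 1) 2).coeff j =
      (peakHalves m).1.coeff (i + 1) + (peakHalves m).2.coeff i := by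
    rintro i (_ | j) h
    · rw [hc0, show i = m by omega, v1 _ (by omega), v2 _ le_rfl, add_zero]
    · rw [hc, s1 (i + 1) j (by omega), s2 i j (by omega)]
  refine ⟨hc0.ge, fun i hi => ?_, fun i hi => ?_⟩ <;> rw [hd] at hi ⊢
  · rcases i with _ | k
    · rw [hc0, Nat.sub_zero, hr0]; exact zero_le_one
    · rw [hr k (m + 1 - (k + 1)) (by omega), hc]
      linarith [m1 k (by omega)]
  · rcases i with _ | k
    · rw [Nat.sub_zero, hr0, hc, peakHalves_fst_coeff_zero]
      linarith [n2 0]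
    · rw [hr k (m + 1 - (k + 1)) (by omega), hc]
      rcases eq_or_ne (2 * k + 2) m with h | h
      · rw [s2 k (k + 1) (by omega)]
      · linarith [m2 k (by omega)]

/-! ### The symmetric decomposition and the polynomial `T`. -/

theorem isSymmetricDecomposition_leftPeakPoly (m : ℕ) :
    IsSymmetricDecomposition (m + 1) (leftPeakPoly (m + 1) 2) (X * (peakHalves m).2)
      (peakHalves m).1 := by
  obtain ⟨s1, s2⟩ := peakHalves_coeff_symm m
  obtain ⟨v1, v2⟩ := peakHalves_coeff_eq_zero m
  refine ⟨by rw [leftPeakPoly_eq_peakHalves]; ring, ⟨?_, ?_⟩, fun k hk => v1 k (by omega),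
    fun i j h => s1 i j (by omega)⟩
  · rintro (_ | k) hk
    · simp
    · rw [coeff_X_mul, v2 k (by omega)]
  · rintro (_ | i) (_ | j) h
    · rfl
    · rw [coeff_X_mul, v2 j (by omega)]; simp
    · rw [coeff_X_mul, v2 i (by omega)]; simp
    · rw [coeff_X_mul, coeff_X_mul, s2 i j (by omega)]

theorem IsSymmetricDecomposition.unique {n : ℕ} {p a b a' b' : ℝ[X]}
    (h : IsSymmetricDecomposition n p a b) (h' : IsSymmetricDecomposition n p a' b') :
    a = a' ∧ b = b' := by
  obtain ⟨e, ⟨va, sa⟩, vb, sb⟩ := h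
  obtain ⟨e', ⟨va', sa'⟩, vb', sb'⟩ := h'
  have e0 : a + X * b = a' + X * b' := e ▸ e'
  have h0 : a.coeff 0 = a'.coeff 0 := by simpa using congrArg (coeff · 0) e0
  have hs : ∀ k, a.coeff (k + 1) + b.coeff k = a'.coeff (k + 1) + b'.coeff k := fun k => by
    simpa [coeff_X_mul] using congrArg (coeff · (k + 1)) e0
  -- Comparing coefficients of index `n - k` and reflecting gives `a_k + b_k`, so `a_k` determines
  -- `b_k`, which in turn determines `a_{k+1}`.
  have hb : ∀ k, a.coeff k = a'.coeff k → b.coeff k = b'.coeff k := by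
    intro k hk
    rcases lt_or_ge k n with h | h
    · have h1 := hs (n - 1 - k)
      rw [sa (n - 1 - k + 1) k (by omega), sa' (n - 1 - k + 1) k (by omega),
        sb (n - 1 - k) k (by omega), sb' (n - 1 - k) k (by omega)] at h1
      linarith
    · rw [vb k (by omega), vb' k (by omega)]
  have ha : ∀ k, a.coeff k = a'.coeff k := by
    intro k
    induction k with
    | zero => exact h0
    | succ k ih => linarith [hs k, hb k ih]
  exact ⟨ext ha, ext fun k => hb k (ha k)⟩

/-- The polynomial `Tₘ₊₁,₂ / X`. -/
noncomputable def peakS (m : ℕ) : ℝ[X] :=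
  (peakHalves m).1.comp (X ^ 2) + X * (peakHalves m).2.comp (X ^ 2)

theorem isPeakT_X_mul_peakS (m : ℕ) : IsPeakT (m + 1) 2 (X * peakS m) := by
  rw [IsPeakT, interiorPeakPoly_eq_peakHalves, leftPeakPoly_eq_peakHalves, peakS]
  simp only [add_comp, mul_comp, X_comp]
  ring

theorem isPeakT_zero : IsPeakT 0 2 1 := by
  simp [IsPeakT, interiorPeakPoly_zero, leftPeakPoly_zero, add_comm]

theorem IsPeakT.unique {n r : ℕ} {T T' : ℝ[X]} (h : IsPeakT n r T) (h' : IsPeakT n r T') :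
    T = T' := by
  have : (1 + X : ℝ[X]) ≠ 0 := by
    rw [add_comm]; exact X_add_C_ne_zero 1
  exact mul_left_cancel₀ this (h.trans h'.symm)

theorem peakS_succ (m : ℕ) : peakS (m + 1) =
    (1 + X + (2 * (m : ℝ[X]) + 1) * X ^ 2) * peakS m + X * (1 - X ^ 2) * derivative (peakS m) := by
  simp only [peakS, peakHalves, add_comp, mul_comp, sub_comp, X_comp, one_comp, ofNat_comp,
    natCast_comp, derivative_add, derivative_mul, derivative_comp, derivative_X,
    derivative_X_pow]
  simp [map_ofNat]
  ring

theorem natDegree_peakS_le (m : ℕ) : (peakS m).natDegree ≤ 2 * m := by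
  induction m with
  | zero => simp [peakS, peakHalves]
  | succ m ih =>
    rw [peakS_succ]
    have h1 : (1 + X + (2 * (m : ℝ[X]) + 1) * X ^ 2).natDegree ≤ 2 := by compute_degree
    have h2 : (X * (1 - X ^ 2) : ℝ[X]).natDegree ≤ 3 := by compute_degree
    have h3 : (derivative (peakS m)).natDegree ≤ 2 * m - 1 :=
      (natDegree_derivative_le _).trans (Nat.sub_le_sub_right ih 1)
    -- For `m = 0` the truncated `2 * m - 1` would only give the bound `3`.
    rcases m with _ | m
    · simp [peakS, peakHalves]
      compute_degree
    · exact natDegree_add_le_of_degree_le (natDegree_mul_le_of_le h1 ih |>.trans (by omega))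
        (natDegree_mul_le_of_le h2 h3 |>.trans (by omega))

/-! ### Strict stability and Hermite–Biehler arguments. -/

/-- A complex polynomial all of whose zeros lie in the open left half-plane. -/
def StrictlyStable (P : ℂ[X]) : Prop := ∀ z : ℂ, 0 ≤ z.re → P.eval z ≠ 0

theorem StrictlyStable.ne_zero {P : ℂ[X]} (h : StrictlyStable P) : P ≠ 0 := by
  rintro rfl
  exact h 0 le_rfl (by simp)

theorem StrictlyStable.re_neg {P : ℂ[X]} (h : StrictlyStable P) {z : ℂ} (hz : z ∈ P.roots) :
    z.re < 0 := by
  by_contra! hre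
  exact h z hre (isRoot_of_mem_roots hz)

theorem re_one_sub_mul_div_nonneg {z w : ℂ} (hz : 0 ≤ z.re) (hw : w.re < 0) :
    0 ≤ ((1 - w * z) / (z - w)).re := by
  rw [Complex.div_re, ← add_div]
  refine div_nonneg ?_ (Complex.normSq_nonneg _)
  simp only [Complex.sub_re, Complex.sub_im, Complex.mul_re, Complex.mul_im, Complex.one_re,
    Complex.one_im]
  nlinarith [mul_nonneg hz (sq_nonneg w.re), mul_nonneg hz (sq_nonneg w.im),
    mul_nonneg (neg_nonneg.2 hw.le) (sq_nonneg z.re),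
    mul_nonneg (neg_nonneg.2 hw.le) (sq_nonneg z.im)]

theorem re_multisetSum_nonneg (s : Multiset ℂ) (h : ∀ z ∈ s, 0 ≤ z.re) : 0 ≤ s.sum.re := by
  induction s using Multiset.induction_on with
  | empty => simp
  | cons a s ih =>
    rw [Multiset.sum_cons, Complex.add_re]
    exact add_nonneg (h a (by simp)) (ih fun z hz => h z (by simp [hz]))

theorem re_multisetSum_pos {s : Multiset ℂ} (hs : s ≠ 0) (h : ∀ z ∈ s, 0 < z.re) :
    0 < s.sum.re := by
  obtain ⟨a, ha⟩ := Multiset.exists_mem_of_ne_zero hs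
  obtain ⟨t, rfl⟩ := Multiset.exists_cons_of_mem ha
  rw [Multiset.sum_cons, Complex.add_re]
  exact add_pos_of_pos_of_nonneg (h a ha)
    (re_multisetSum_nonneg t fun z hz => (h z (by simp [hz])).le)

theorem multisetProd_map_lt {s : Multiset ℂ} {f g : ℂ → ℝ} (hf : ∀ w ∈ s, 0 ≤ f w)
    (h : ∀ w ∈ s, f w < g w) (hs : s ≠ 0) : (s.map f).prod < (s.map g).prod := by
  induction s using Multiset.induction_on with
  | empty => exact absurd rfl hs
  | cons a s ih =>
    simp only [Multiset.map_cons, Multiset.prod_cons]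
    have h0 : 0 ≤ (s.map f).prod := by
      refine Multiset.prod_nonneg fun x hx => ?_
      obtain ⟨w, hw, rfl⟩ := Multiset.mem_map.1 hx
      exact hf w (by simp [hw])
    rcases eq_or_ne s 0 with rfl | hs'
    · simpa using h a (by simp)
    · exact mul_lt_mul'' (h a (by simp))
        (ih (fun w hw => hf w (by simp [hw])) (fun w hw => h w (by simp [hw])) hs')
        (hf a (by simp)) h0

/-- With `P'/P = ∑ 1/(z - w)` and `(1 - z²)/(z - w) = (1 - wz)/(z - w) - z`, the new value divided
by `z P(z)` is `1/z + 1 + (N + 1 - deg P) z + σ`. For `Re z ≥ 0`, `z ≠ 0`, every summand has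
nonnegative real part, and the `1` makes the total positive. -/
theorem StrictlyStable.step {P : ℂ[X]} (h : StrictlyStable P) {N : ℕ} (hN : P.natDegree ≤ N) :
    StrictlyStable ((1 + X + ((N : ℂ[X]) + 1) * X ^ 2) * P + X * (1 - X ^ 2) * derivative P) := by
  intro z hz
  have hPz := h z hz
  have hsp := IsAlgClosed.splits P
  simp only [eval_add, eval_mul, eval_sub, eval_pow, eval_X, eval_one, eval_natCast]
  rcases eq_or_ne z 0 with rfl | hz0
  · simpa using hPz
  set σ := (P.roots.map fun w => (1 - w * z) / (z - w)).sum with hσ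
  have hsum : (1 - z ^ 2) * (P.roots.map fun w => 1 / (z - w)).sum = σ - P.natDegree * z := by
    rw [← Multiset.sum_map_mul_left, hsp.natDegree_eq_card_roots, hσ, ← nsmul_eq_mul,
      ← Multiset.sum_replicate, ← Multiset.map_const', ← Multiset.sum_map_sub]
    refine congrArg _ (Multiset.map_congr rfl fun w hw => ?_)
    have : z - w ≠ 0 := fun h0 => hPz (by rw [sub_eq_zero.1 h0]; exact isRoot_of_mem_roots hw)
    field_simp
    ring
  have hσ0 : 0 ≤ σ.re := by
    refine re_multisetSum_nonneg _ fun x hx => ?_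
    obtain ⟨w, hw, rfl⟩ := Multiset.mem_map.1 hx
    exact re_one_sub_mul_div_nonneg hz (h.re_neg hw)
  have key : (1 + z + ((N : ℂ) + 1) * z ^ 2) * P.eval z +
      z * (1 - z ^ 2) * (derivative P).eval z =
      P.eval z * z * (z⁻¹ + 1 + ((N + 1 - P.natDegree : ℝ) : ℂ) * z + σ) := by
    rw [hsp.eval_derivative_eq_eval_mul_sum hPz]
    push_cast
    have : z * z⁻¹ = 1 := mul_inv_cancel₀ hz0
    linear_combination (P.eval z * z) * hsum - P.eval z * this
  rw [key]
  refine mul_ne_zero (mul_ne_zero hPz hz0) fun h0 => ?_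
  have h1 := congrArg Complex.re h0
  simp only [Complex.add_re, Complex.one_re, Complex.re_ofReal_mul, Complex.zero_re,
    Complex.inv_re] at h1
  have h2 := div_nonneg hz (Complex.normSq_nonneg z)
  have h3 : (P.natDegree : ℝ) ≤ N := by exact_mod_cast hN
  have h4 := mul_nonneg (by linarith : (0 : ℝ) ≤ N + 1 - P.natDegree) hz
  linarith

/-- As `S` is real, `-z` may be replaced by `-conj z`, the mirror image of `z` in the imaginary
axis, which is closer to every zero of `S`. -/
theorem StrictlyStable.norm_eval_neg_lt {S : ℝ[X]} (h : StrictlyStable (S.map (algebraMap ℝ ℂ)))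
    (hd : 0 < S.natDegree) {z : ℂ} (hz : 0 < z.re) : ‖aeval (-z) S‖ < ‖aeval z S‖ := by
  set P := S.map (algebraMap ℝ ℂ) with hP
  have hsp := IsAlgClosed.splits P
  have hn : ∀ y : ℂ, ‖aeval y S‖ = ‖P.leadingCoeff‖ * (P.roots.map fun w => ‖y - w‖).prod := by
    intro y
    rw [← eval_map_algebraMap, hsp.eval_eq_prod_roots, norm_mul]
    refine congrArg _ ((map_multiset_prod (normHom : ℂ →*₀ ℝ) _).trans ?_)
    rw [Multiset.map_map]
    rfl
  have hconj : ‖aeval (-z) S‖ = ‖aeval (-(starRingEnd ℂ z)) S‖ := by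
    rw [← map_neg, aeval_conj, Complex.norm_conj]
  rw [hconj, hn, hn]
  refine mul_lt_mul_of_pos_left (multisetProd_map_lt (fun _ _ => norm_nonneg _) (fun w hw => ?_) ?_)
    (norm_pos_iff.2 (leadingCoeff_ne_zero.2 h.ne_zero))
  · have hw := h.re_neg hw
    rw [← sq_lt_sq₀ (norm_nonneg _) (norm_nonneg _), ← Complex.normSq_eq_norm_sq,
      ← Complex.normSq_eq_norm_sq]
    simp only [Complex.normSq_apply, Complex.sub_re, Complex.sub_im, Complex.neg_re,
      Complex.neg_im, Complex.conj_re, Complex.conj_im]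
    nlinarith [mul_pos hz (neg_pos.2 hw)]
  · refine hsp.roots_ne_zero ?_
    rw [hP, natDegree_map]
    exact hd.ne'

/-- The Wronskian is `|P(it)|² Re (P'/P)(it)`, and each `1/(it - w)` with `Re w < 0` has positive
real part. -/
theorem StrictlyStable.wronskian_pos {P : ℂ[X]} (h : StrictlyStable P) (hd : 0 < P.natDegree)
    {A B : ℝ[X]} (hP : P.comp (C Complex.I * X) =
      A.map (algebraMap ℝ ℂ) + C Complex.I * B.map (algebraMap ℝ ℂ)) (t : ℝ) :
    0 < A.eval t * (derivative B).eval t - (derivative A).eval t * B.eval t := by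
  have hsp := IsAlgClosed.splits P
  have hre : 0 ≤ (Complex.I * t).re := by simp
  have hPz := h _ hre
  have hm : ∀ p : ℝ[X], (p.map (algebraMap ℝ ℂ)).eval (t : ℂ) = (p.eval t : ℝ) := by
    intro p
    exact eval_map_apply (algebraMap ℝ ℂ) t
  have e0 : P.eval (Complex.I * t) = A.eval t + Complex.I * B.eval t := by
    have := congrArg (eval (t : ℂ)) hP
    simpa only [eval_comp, eval_mul, eval_C, eval_X, eval_add, hm] using this
  have e1 : Complex.I * (derivative P).eval (Complex.I * t) =
      (derivative A).eval t + Complex.I * (derivative B).eval t := by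
    have := congrArg (fun p => eval (t : ℂ) (derivative p)) hP
    simpa only [derivative_comp, derivative_add, derivative_mul, derivative_C, derivative_X,
      zero_mul, zero_add, mul_one, derivative_map, eval_comp, eval_mul, eval_C, eval_X, eval_add,
      hm] using this
  set σ := (P.roots.map fun w => 1 / (Complex.I * t - w)).sum with hσ
  have hσ0 : 0 < σ.re := by
    refine re_multisetSum_pos ?_ fun x hx => ?_
    · rw [Ne, Multiset.map_eq_zero]
      exact hsp.roots_ne_zero hd.ne'
    · obtain ⟨w, hw, rfl⟩ := Multiset.mem_map.1 hx
      have hw := h.re_neg hw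
      have hne : Complex.I * t - w ≠ 0 := by
        intro h0
        have := congrArg Complex.re h0
        simp at this
        linarith
      rw [one_div, Complex.inv_re]
      refine div_pos ?_ (Complex.normSq_pos.2 hne)
      simp [hw]
  have e2 : (derivative P).eval (Complex.I * t) = P.eval (Complex.I * t) * σ :=
    hsp.eval_derivative_eq_eval_mul_sum hPz
  rw [e2, e0] at e1
  have r1 := congrArg Complex.re e1
  have r2 := congrArg Complex.im e1
  have hne : 0 < A.eval t ^ 2 + B.eval t ^ 2 := by
    by_contra! hle
    have a0 : A.eval t = 0 := by nlinarith [sq_nonneg (A.eval t), sq_nonneg (B.eval t)]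
    have b0 : B.eval t = 0 := by nlinarith [sq_nonneg (A.eval t), sq_nonneg (B.eval t)]
    exact hPz (by rw [e0, a0, b0]; simp)
  simp at r1 r2
  rw [← r1, ← r2]
  linarith [mul_pos hne hσ0]

/-- Otherwise Rolle's theorem applies to `A / B`, whose derivative never vanishes. At `u` and `v`
the Wronskian itself excludes a zero of `B`. -/
theorem exists_root_between_of_wronskian_pos {A B : ℝ[X]}
    (h : ∀ t : ℝ, 0 < A.eval t * (derivative B).eval t - (derivative A).eval t * B.eval t)
    {u v : ℝ} (huv : u < v) (hu : A.eval u = 0) (hv : A.eval v = 0) :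
    ∃ t ∈ Set.Ioo u v, B.eval t = 0 := by
  by_contra! hB
  have hB' : ∀ t ∈ Set.Icc u v, B.eval t ≠ 0 := by
    intro t ht h0
    have hW := h t
    rcases eq_or_ne t u with rfl | hu'
    · rw [hu, h0] at hW; simp at hW
    rcases eq_or_ne t v with rfl | hv'
    · rw [hv, h0] at hW; simp at hW
    · exact hB t ⟨lt_of_le_of_ne ht.1 hu'.symm, lt_of_le_of_ne ht.2 hv'⟩ h0
  obtain ⟨t, ht, hd⟩ := exists_hasDerivAt_eq_zero (f := fun t => A.eval t / B.eval t)
    (f' := fun t => ((derivative A).eval t * B.eval t - A.eval t * (derivative B).eval t) /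
      B.eval t ^ 2) huv (A.continuousOn.div B.continuousOn hB') (by simp [hu, hv])
    fun t ht => (A.hasDerivAt t).div (B.hasDerivAt t) (hB t ht)
  rcases div_eq_zero_iff.1 hd with h0 | h0
  · linarith [h t]
  · exact hB t ht (pow_eq_zero_iff (two_ne_zero) |>.1 h0)

theorem eq_C_leadingCoeff_mul_prod_range {p : ℝ[X]} {m : ℕ} (hp : p.natDegree ≤ m) (hp0 : p ≠ 0)
    {r : ℕ → ℝ} (hr : ∀ i < m, p.eval (r i) = 0) (hinj : ∀ i j, i < j → j < m → r i ≠ r j) :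
    p = C p.leadingCoeff * ∏ i ∈ Finset.range m, (X - C (r i)) := by
  have hdvd : ∏ i ∈ Finset.range m, (X - C (r i)) ∣ p := by
    refine Finset.prod_dvd_of_coprime (fun i hi j hj hij => ?_) fun i hi =>
      dvd_iff_isRoot.2 (hr i (Finset.mem_range.1 hi))
    refine isCoprime_X_sub_C_of_isUnit_sub (IsUnit.mk0 _ (sub_ne_zero.2 ?_))
    simp only [Finset.coe_range, Set.mem_Iio] at hi hj
    rcases lt_or_gt_of_ne hij with h | h
    · exact hinj i j h hj
    · exact (hinj j i h hi).symm
  have hmon : (∏ i ∈ Finset.range m, (X - C (r i))).Monic := monic_prod_X_sub_C _ _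
  obtain ⟨q, hq⟩ := hdvd
  have hq0 : q ≠ 0 := by rintro rfl; simp [hp0] at hq
  have hdeg : q.natDegree = 0 := by
    have := hmon.natDegree_mul' hq0
    rw [← hq, natDegree_finsetProd_X_sub_C_eq_card, Finset.card_range] at this
    omega
  obtain ⟨a, rfl⟩ := natDegree_eq_zero.1 hdeg
  have hl : p.leadingCoeff = a := by
    rw [hq, leadingCoeff_mul, hmon.leadingCoeff, one_mul, leadingCoeff_C]
  rw [hl]
  conv_lhs => rw [hq]
  rw [mul_comm]

/-! ### Stability of `T`, and real-rootedness and interlacing of `b` and `c`. -/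

theorem strictlyStable_peakS (m : ℕ) : StrictlyStable ((peakS m).map (algebraMap ℝ ℂ)) := by
  induction m with
  | zero => intro z _; simp [peakS, peakHalves]
  | succ m ih =>
    have := ih.step (N := 2 * m) (by rw [natDegree_map]; exact natDegree_peakS_le m)
    rw [peakS_succ]
    simpa [Polynomial.map_add, Polynomial.map_mul, derivative_map] using this

theorem peakS_natDegree (m : ℕ) : (peakS m).natDegree = 2 * m := by
  refine le_antisymm (natDegree_peakS_le m) (le_natDegree_of_ne_zero ?_)
  rw [peakS, ← expand_eq_comp_X_pow, ← expand_eq_comp_X_pow, coeff_add, mul_comm 2 m,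
    coeff_expand_mul two_pos, peakHalves_fst_coeff_self]
  rcases m with _ | m
  · simp
  · rw [show (m + 1) * 2 = 2 * m + 1 + 1 by ring, coeff_X_mul, coeff_expand two_pos,
      if_neg (by omega), add_zero]
    exact one_ne_zero

theorem hurwitzStable_of_isPeakT {n : ℕ} {T : ℝ[X]} (h : IsPeakT n 2 T) : HurwitzStable T := by
  refine Or.inr fun z hz => ?_
  rcases n with _ | m
  · rw [h.unique isPeakT_zero]; simp
  · rw [h.unique (isPeakT_X_mul_peakS m), map_mul, aeval_X]
    refine mul_ne_zero (fun h0 => by simp [h0] at hz) ?_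
    have := strictlyStable_peakS m z hz.le
    rwa [eval_map_algebraMap] at this

/-- If `b(w) = 0` and `z² = w`, then `S(±z) = ±z c(w)` have equal norm, which
`StrictlyStable.norm_eval_neg_lt` forbids unless `z` is purely imaginary. -/
theorem exists_neg_sq_of_root_peakHalves_fst {m : ℕ} (hm : 0 < m) {w : ℂ}
    (hw : aeval w (peakHalves m).1 = 0) : ∃ t : ℝ, w = ((-t ^ 2 : ℝ) : ℂ) := by
  obtain ⟨z, hz⟩ := IsAlgClosed.exists_pow_nat_eq w (n := 2) two_pos
  have key : ∀ z : ℂ, z ^ 2 = w → ¬ 0 < z.re := by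
    intro z hz hre
    have hS : ∀ y : ℂ, y ^ 2 = w → aeval y (peakS m) = y * aeval w (peakHalves m).2 := by
      intro y hy
      rw [peakS, map_add, map_mul, aeval_comp, aeval_comp, map_pow, aeval_X, hy, hw, zero_add]
    have := (strictlyStable_peakS m).norm_eval_neg_lt (by rw [peakS_natDegree]; omega) hre
    rw [hS z hz, hS (-z) (by rw [neg_sq, hz]), neg_mul, norm_neg] at this
    exact this.false
  have h1 := key z hz
  have h2 := key (-z) (by rw [neg_sq, hz])
  rw [Complex.neg_re] at h2
  have h0 : z.re = 0 := by linarith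
  refine ⟨z.im, ?_⟩
  rw [← hz]
  apply Complex.ext <;> simp [pow_two, h0]

theorem peakHalves_fst_splits (m : ℕ) : (peakHalves m).1.Splits := by
  rcases Nat.eq_zero_or_pos m with rfl | hm
  · simp [peakHalves]
  refine Splits.of_splits_map (algebraMap ℝ ℂ) (IsAlgClosed.splits _) fun w hw => ?_
  have := isRoot_of_mem_roots hw
  rw [IsRoot, eval_map_algebraMap] at this
  obtain ⟨t, rfl⟩ := exists_neg_sq_of_root_peakHalves_fst hm this
  exact ⟨_, rfl⟩

theorem peakHalves_fst_root_neg {m : ℕ} {y : ℝ} (hy : (peakHalves m).1.eval y = 0) : y < 0 := by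
  have hm : 0 < m := by
    rcases Nat.eq_zero_or_pos m with rfl | hm
    · simp [peakHalves] at hy
    · exact hm
  have h : aeval (y : ℂ) (peakHalves m).1 = 0 := by
    have := aeval_algebraMap_apply ℂ y (peakHalves m).1
    rw [coe_aeval_eq_eval, hy] at this
    simpa using this
  obtain ⟨t, ht⟩ := exists_neg_sq_of_root_peakHalves_fst hm h
  have ht : y = -t ^ 2 := by exact_mod_cast ht
  refine lt_of_le_of_ne (by rw [ht]; nlinarith [sq_nonneg t]) ?_
  rintro rfl
  rw [← coeff_zero_eq_eval_zero, peakHalves_fst_coeff_zero] at hy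
  exact one_ne_zero hy

/-- On the imaginary axis `S(it) = b(-t²) + i · t c(-t²)`. -/
theorem peakHalves_wronskian_pos {m : ℕ} (hm : 0 < m) (t : ℝ) :
    0 < ((peakHalves m).1.comp (-X ^ 2)).eval t *
        (derivative (X * (peakHalves m).2.comp (-X ^ 2))).eval t -
      (derivative ((peakHalves m).1.comp (-X ^ 2))).eval t *
        (X * (peakHalves m).2.comp (-X ^ 2)).eval t := by
  refine (strictlyStable_peakS m).wronskian_pos
    (by rw [natDegree_map, peakS_natDegree]; omega) ?_ t
  have h : (X ^ 2 : ℂ[X]).comp (C Complex.I * X) = -X ^ 2 := by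
    rw [X_pow_comp, mul_pow, ← C_pow, Complex.I_sq, C_neg, C_1, neg_one_mul]
  simp only [peakS, Polynomial.map_add, Polynomial.map_mul, map_comp, Polynomial.map_pow, map_X,
    Polynomial.map_neg, add_comp, mul_comp, X_comp, comp_assoc, h]
  ring

theorem exists_root_peakHalves_snd {m : ℕ} {x y : ℝ} (hxy : x < y)
    (hx : (peakHalves m).1.eval x = 0) (hy : (peakHalves m).1.eval y = 0) :
    ∃ z ∈ Set.Ioo x y, (peakHalves m).2.eval z = 0 := by
  have hm : 0 < m := by
    rcases Nat.eq_zero_or_pos m with rfl | hm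
    · simp [peakHalves] at hy
    · exact hm
  have hx0 := peakHalves_fst_root_neg hx
  have hy0 := peakHalves_fst_root_neg hy
  have ex : -√(-x) ^ 2 = x := by rw [Real.sq_sqrt (by linarith), neg_neg]
  have ey : -√(-y) ^ 2 = y := by rw [Real.sq_sqrt (by linarith), neg_neg]
  obtain ⟨t, ⟨h1, h2⟩, ht⟩ := exists_root_between_of_wronskian_pos (peakHalves_wronskian_pos hm)
    (Real.sqrt_lt_sqrt (by linarith) (neg_lt_neg hxy)) (by simp [eval_comp, ey, hy])
    (by simp [eval_comp, ex, hx])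
  have ht0 : 0 < t := (Real.sqrt_nonneg _).trans_lt h1
  refine ⟨-t ^ 2, ⟨?_, ?_⟩, ?_⟩
  · rw [← ex]
    exact neg_lt_neg (pow_lt_pow_left₀ h2 ht0.le two_ne_zero)
  · rw [← ey]
    exact neg_lt_neg (pow_lt_pow_left₀ h1 (Real.sqrt_nonneg _) two_ne_zero)
  · simpa [eval_comp, ht0.ne'] using ht

theorem peakHalves_fst_roots_nodup {m : ℕ} : (peakHalves m).1.roots.Nodup := by
  rw [Multiset.nodup_iff_count_le_one]
  intro y
  rw [count_roots]
  by_contra! h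
  obtain ⟨h0, h1⟩ := (one_lt_rootMultiplicity_iff_isRoot (peakHalves_fst_monic m).ne_zero).1 h
  rw [IsRoot] at h0 h1
  have hm : 0 < m := by
    rcases Nat.eq_zero_or_pos m with rfl | hm
    · simp [peakHalves] at h0
    · exact hm
  have hy0 := peakHalves_fst_root_neg h0
  have ey : -√(-y) ^ 2 = y := by rw [Real.sq_sqrt (by linarith), neg_neg]
  -- At a double zero `y` of `b`, both `b(-t²)` and its derivative vanish at `t = √(-y)`, and so
  -- does the Wronskian.
  have := peakHalves_wronskian_pos hm √(-y)
  rw [derivative_comp, eval_mul, eval_comp, eval_comp] at this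
  simp only [eval_neg, eval_pow, eval_X, ey, h0, h1] at this
  simp at this

theorem exists_strictAnti_roots_peakHalves_fst (m : ℕ) : ∃ s : ℕ → ℝ,
    (∀ i < m, (peakHalves m).1.eval (s i) = 0) ∧ ∀ i j, i < j → j < m → s j < s i := by
  have hcard : (peakHalves m).1.roots.toFinset.card = m := by
    rw [Multiset.toFinset_card_of_nodup peakHalves_fst_roots_nodup,
      ← (peakHalves_fst_splits m).natDegree_eq_card_roots, peakHalves_fst_natDegree]
  set e := (peakHalves m).1.roots.toFinset.orderEmbOfFin hcard
  refine ⟨fun i => if h : i < m then e (Fin.rev ⟨i, h⟩) else 0, fun i hi => ?_,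
    fun i j hij hj => ?_⟩
  · simp only [hi, dif_pos]
    have := Finset.orderEmbOfFin_mem (peakHalves m).1.roots.toFinset hcard (Fin.rev ⟨i, hi⟩)
    exact isRoot_of_mem_roots (Multiset.mem_toFinset.1 this)
  · simp only [hj, hij.trans hj, dif_pos]
    exact e.strictMono (Fin.rev_lt_rev.2 hij)

theorem properPosition_peakHalves (m : ℕ) :
    ProperPosition (peakHalves m).1 (X * (peakHalves m).2) := by
  rcases m with _ | k
  · exact Or.inr (Or.inr (Or.inr ⟨by simp [peakHalves], peakHalves_fst_splits 0⟩))
  set m := k + 1 with hm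
  have v2 := (peakHalves_coeff_eq_zero m).2
  have n2 := (peakHalves_coeff_nonneg m).2
  have hb0 := (peakHalves_fst_monic m).ne_zero
  have hc0 : (peakHalves m).2 ≠ 0 := by
    intro h
    have h1 := (coeff_zero_peakHalves_succ k).2
    rw [← hm, h, peakHalves_fst_coeff_zero, coeff_zero] at h1
    linarith [(peakHalves_coeff_nonneg k).2 0]
  have ha0 : X * (peakHalves m).2 ≠ 0 := mul_ne_zero X_ne_zero hc0
  have had : (X * (peakHalves m).2).natDegree ≤ m := by
    rw [natDegree_X_mul hc0, hm]
    exact Nat.succ_le_succ (natDegree_le_iff_coeff_eq_zero.2 fun j hj => v2 j (by omega))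
  have hal : 0 < (X * (peakHalves m).2).leadingCoeff := by
    rw [leadingCoeff_mul, leadingCoeff_X, one_mul]
    exact lt_of_le_of_ne (n2 _) (leadingCoeff_ne_zero.2 hc0).symm
  obtain ⟨s, hs, hanti⟩ := exists_strictAnti_roots_peakHalves_fst m
  have hex : ∀ i, ∃ z, i + 1 < m → z ∈ Set.Ioo (s (i + 1)) (s i) ∧
      (peakHalves m).2.eval z = 0 := by
    intro i
    by_cases hi : i + 1 < m
    · obtain ⟨z, hz, h0⟩ := exists_root_peakHalves_snd (hanti i (i + 1) (by omega) hi)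
        (hs _ hi) (hs i (by omega))
      exact ⟨z, fun _ => ⟨hz, h0⟩⟩
    · exact ⟨0, fun h => absurd h hi⟩
  choose q hq using hex
  -- The largest zero `0` comes from the factor `X`; the others are the zeros of `c` in the gaps of
  -- `s`.
  set r : ℕ → ℝ := fun i => Nat.casesOn i 0 q with hr
  have hsr : ∀ i < m, s i < r i := by
    rintro (_ | i) hi
    · exact peakHalves_fst_root_neg (hs 0 hi)
    · exact (hq i hi).1.1
  have hrs : ∀ i, i + 1 < m → r (i + 1) < s i := fun i hi => (hq i hi).1.2
  have hle : ∀ i j, i ≤ j → j < m → s j ≤ s i := by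
    intro i j hij hj
    rcases hij.eq_or_lt with rfl | h
    · exact le_rfl
    · exact (hanti i j h hj).le
  refine Or.inl ⟨⟨ha0, hb0, m, m, r, s, Or.inr rfl, ?_, ?_, fun i hi => (hsr i hi).le,
    fun i hi => (hrs i hi).le⟩, ?_⟩
  · refine eq_C_leadingCoeff_mul_prod_range had ha0 ?_ ?_
    · rintro (_ | i) hi
      · simp [hr]
      · rw [eval_mul]
        exact mul_eq_zero_of_right _ (hq i hi).2
    · rintro i (_ | j) hij hj
      · omega
      · exact ((hrs j hj).trans_le (hle i j (by omega) (by omega)) |>.trans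
          (hsr i (by omega))).ne'
  · exact eq_C_leadingCoeff_mul_prod_range (peakHalves_fst_natDegree m).le hb0 hs
      fun i j hij hj => (hanti i j hij hj).ne'
  · rw [(peakHalves_fst_monic m).leadingCoeff, one_mul]
    exact hal

theorem isSymmetricDecomposition_leftPeakPoly_zero :
    IsSymmetricDecomposition 0 (leftPeakPoly 0 2) 1 0 := by
  refine ⟨by simp [leftPeakPoly_zero], ⟨fun k hk => ?_, fun i j h => ?_⟩, by simp, by simp⟩
  · rw [coeff_one, if_neg (by omega)]
  · rw [show i = j by omega]

theorem properPosition_of_isSymmetricDecomposition {n : ℕ} {a b : ℝ[X]}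
    (h : IsSymmetricDecomposition n (leftPeakPoly n 2) a b) : ProperPosition b a := by
  rcases n with _ | m
  · obtain ⟨rfl, rfl⟩ := h.unique isSymmetricDecomposition_leftPeakPoly_zero
    exact Or.inr (Or.inr (Or.inl ⟨rfl, Splits.one⟩))
  · obtain ⟨rfl, rfl⟩ := h.unique (isSymmetricDecomposition_leftPeakPoly m)
    exact properPosition_peakHalves m

theorem mainTheorem9 (n : ℕ) :
    ((∃ T : ℝ[X], IsPeakT n 2 T) ∧ ∀ T : ℝ[X], IsPeakT n 2 T → HurwitzStable T) ∧
    ((∃ a b : ℝ[X], IsSymmetricDecomposition n (leftPeakPoly n 2) a b) ∧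
      ∀ a b : ℝ[X], IsSymmetricDecomposition n (leftPeakPoly n 2) a b → ProperPosition b a) ∧
    AlternatinglyIncreasing (interiorPeakPoly n 2) ∧
    AlternatinglyIncreasing (leftPeakPoly n 2) := by
  refine ⟨⟨?_, fun T => hurwitzStable_of_isPeakT⟩,
    ⟨?_, fun a b => properPosition_of_isSymmetricDecomposition⟩,
    alternatinglyIncreasing_interiorPeakPoly n, alternatinglyIncreasing_leftPeakPoly n⟩
  · rcases n with _ | m
    · exact ⟨_, isPeakT_zero⟩
    · exact ⟨_, isPeakT_X_mul_peakS m⟩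
  · rcases n with _ | m
    · exact ⟨_, _, isSymmetricDecomposition_leftPeakPoly_zero⟩
    · exact ⟨_, _, isSymmetricDecomposition_leftPeakPoly m⟩
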